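/- Let $(K,\nu_0)$ be a valued field, with value group contained in a fixed totally ordered divisible abelian group $\Gamma$, and let $F\in K[x]$ be monic and irreducible. All valuations below take values in $\Gamma\cup\{\infty\}$; a valuation $\nu$ on a commutative ring satisfies $\nu(ab)=\nu(a)+\nu(b)$, $\nu(a+b)\ge\min\{\nu(a),\nu(b)\}$, $\nu(1)=0$, $\nu(0)=\infty$, and may take the value $\infty$ on nonzero elements. For a valuation $\nu$ on $K[x]$ let $$\mathcal G_\nu=\bigoplus_{\gamma\in\nu(K[x]),\ \gamma<\infty}\mathcal P_\gamma/\mathcal P_\gamma^+,\qquad \mathcal P_\gamma=\{f\mid \nu(f)\ge\gamma\},\quad \mathcal P_\gamma^+=\{f\mid\nu(f)>\gamma\},$$ be its associated graded ring. For $f\in K[x]$ let $\mathrm{in}_\nu(f)$ be the image of $f$ in $\mathcal P_{\nu(f)}/\mathcal P_{\nu(f)}^+\subseteq\mathcal G_\nu$ if $\nu(f)<\infty$, and $\mathrm{in}_\nu(f)=0$ if $\nu(f)=\infty$. Suppose that $\mu$ is the only extension of $\nu_0$ to a valuation on $L=K[x]/(F)$, and regard $\mu$ also as a valuation on $K[x]$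 with support $(F)$ through $K[x]\to L$. Then for every valuation $\nu$ on $K[x]$ that extends $\nu_0$ and satisfies $\nu<\mu$ (that is, $\nu(f)\le\mu(f)$ for every $f\in K[x]$, and $\nu\ne\mu$) there exist an irreducible element $\phi$ of $\mathcal G_\nu$, a unit $u$ of $\mathcal G_\nu$ and an integer $r\ge 1$ such that $$\mathrm{in}_\nu(F)=u\cdot\phi^r .$$ -/

import Mathlib

open Polynomial

namespace GradedVal

variable {R : Type*} [CommRing R]
  {Γ : Type*} [AddCommGroup Γ] [LinearOrder Γ] [IsOrderedAddMonoid Γ]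

/-- The finite values of `ν`. They are closed under addition because `ν (a * b) = ν a + ν b`. -/
def valueMonoid (ν : AddValuation R (WithTop Γ)) : AddSubmonoid Γ where
  carrier := {γ | ∃ a : R, ν a = (γ : WithTop Γ)}
  zero_mem' := ⟨1, by simp⟩
  add_mem' := by
    rintro γ δ ⟨a, ha⟩ ⟨b, hb⟩
    exact ⟨a * b, by rw [ν.map_mul, ha, hb, WithTop.coe_add]⟩

/-- The group `P_γ = {a ∈ R ∣ ν a ≥ γ}`. -/
def P (ν : AddValuation R (WithTop Γ)) (γ : Γ) : AddSubgroup R where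
  carrier := {a | (γ : WithTop Γ) ≤ ν a}
  zero_mem' := by simp
  add_mem' := fun {a b} ha hb => ν.map_le_add ha hb
  neg_mem' := fun {a} ha => by simpa [ν.map_neg] using ha

/-- The group `P_γ⁺ = {a ∈ R ∣ ν a > γ}`. -/
def PPlus (ν : AddValuation R (WithTop Γ)) (γ : Γ) : AddSubgroup R where
  carrier := {a | (γ : WithTop Γ) < ν a}
  zero_mem' := by simp
  add_mem' := fun {a b} ha hb => ν.map_lt_add ha hb
  neg_mem' := fun {a} ha => by simpa [ν.map_neg] using ha

theorem mul_mem_P (ν : AddValuation R (WithTop Γ)) {γ δ : Γ} {a b : R}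
    (ha : a ∈ P ν γ) (hb : b ∈ P ν δ) : a * b ∈ P ν (γ + δ) := by
  change ((γ + δ : Γ) : WithTop Γ) ≤ ν (a * b)
  rw [ν.map_mul, WithTop.coe_add]
  exact add_le_add ha hb

theorem mul_mem_PPlus_left (ν : AddValuation R (WithTop Γ)) {γ δ : Γ} {a b : R}
    (ha : a ∈ PPlus ν γ) (hb : b ∈ P ν δ) : a * b ∈ PPlus ν (γ + δ) := by
  change ((γ + δ : Γ) : WithTop Γ) < ν (a * b)
  rw [ν.map_mul, WithTop.coe_add]
  exact WithTop.add_lt_add_of_lt_of_le WithTop.coe_ne_top ha hb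

/-- The homogeneous component `P_γ / P_γ⁺` of degree `γ`, for `γ` a finite value of `ν`. -/
abbrev Component (ν : AddValuation R (WithTop Γ)) (γ : valueMonoid ν) : Type _ :=
  P ν (γ : Γ) ⧸ (PPlus ν (γ : Γ)).addSubgroupOf (P ν (γ : Γ))

/-- The class of `a` in `P_γ / P_γ⁺`. -/
def cls (ν : AddValuation R (WithTop Γ)) (γ : valueMonoid ν) (a : R) (ha : a ∈ P ν (γ : Γ)) :
    Component ν γ :=
  QuotientAddGroup.mk ⟨a, ha⟩

theorem cls_surj (ν : AddValuation R (WithTop Γ)) (γ : valueMonoid ν) (x : Component ν γ) :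
    ∃ a ha, cls ν γ a ha = x := by
  induction x using QuotientAddGroup.induction_on with
  | H z => exact ⟨z.1, z.2, rfl⟩

theorem cls_eq_iff (ν : AddValuation R (WithTop Γ)) (γ : valueMonoid ν) {a b : R}
    (ha : a ∈ P ν (γ : Γ)) (hb : b ∈ P ν (γ : Γ)) :
    cls ν γ a ha = cls ν γ b hb ↔ -a + b ∈ PPlus ν (γ : Γ) := by
  unfold cls
  rw [QuotientAddGroup.eq, AddSubgroup.mem_addSubgroupOf]
  rfl

/-- Multiplication of homogeneous elements: the class of `a` times the class of `b` is the class
of `a * b`. -/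
def componentMul (ν : AddValuation R (WithTop Γ)) {γ δ : valueMonoid ν}
    (x : Component ν γ) (y : Component ν δ) : Component ν (γ + δ) :=
  Quotient.liftOn₂ x y
    (fun a b => cls ν (γ + δ) (a.1 * b.1) (mul_mem_P ν a.2 b.2))
    (by
      rintro ⟨a, ha⟩ ⟨b, hb⟩ ⟨a', ha'⟩ ⟨b', hb'⟩ h₁ h₂
      have h₁ : -a + a' ∈ PPlus ν (γ : Γ) :=
        (cls_eq_iff ν γ ha ha').1 (Quotient.sound h₁)
      have h₂ : -b + b' ∈ PPlus ν (δ : Γ) :=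
        (cls_eq_iff ν δ hb hb').1 (Quotient.sound h₂)
      refine (cls_eq_iff ν _ _ _).2 ?_
      have e : -(a * b) + a' * b' = (-a + a') * b + (-b + b') * a' := by ring
      have h₃ := mul_mem_PPlus_left ν h₂ ha'
      rw [add_comm (δ : Γ)] at h₃
      change -(a * b) + a' * b' ∈ PPlus ν ((γ : Γ) + δ)
      rw [e]
      exact add_mem (mul_mem_PPlus_left ν h₁ hb) h₃)

theorem componentMul_cls (ν : AddValuation R (WithTop Γ)) {γ δ : valueMonoid ν} {a b : R}
    (ha : a ∈ P ν (γ : Γ)) (hb : b ∈ P ν (δ : Γ)) :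
    componentMul ν (cls ν γ a ha) (cls ν δ b hb) = cls ν (γ + δ) (a * b) (mul_mem_P ν ha hb) :=
  rfl

theorem cls_add (ν : AddValuation R (WithTop Γ)) (γ : valueMonoid ν) {a b : R}
    (ha : a ∈ P ν (γ : Γ)) (hb : b ∈ P ν (γ : Γ)) :
    cls ν γ a ha + cls ν γ b hb = cls ν γ (a + b) (add_mem ha hb) :=
  rfl

theorem cls_zero (ν : AddValuation R (WithTop Γ)) (γ : valueMonoid ν) :
    cls ν γ 0 (zero_mem _) = 0 :=
  rfl

theorem one_mem_P (ν : AddValuation R (WithTop Γ)) :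
    (1 : R) ∈ P ν ((0 : valueMonoid ν) : Γ) := by
  change (((0 : valueMonoid ν) : Γ) : WithTop Γ) ≤ ν 1
  simp

theorem cls_congr (ν : AddValuation R (WithTop Γ)) {γ δ : valueMonoid ν} {a b : R}
    (h : γ = δ) (hab : a = b) (ha : a ∈ P ν (γ : Γ)) (hb : b ∈ P ν (δ : Γ)) :
    GradedMonoid.mk (A := Component ν) γ (cls ν γ a ha) = GradedMonoid.mk δ (cls ν δ b hb) := by
  subst h hab
  rfl

instance instGMul (ν : AddValuation R (WithTop Γ)) : GradedMonoid.GMul (Component ν) where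
  mul := componentMul ν

instance instGOne (ν : AddValuation R (WithTop Γ)) : GradedMonoid.GOne (Component ν) where
  one := cls ν 0 1 (one_mem_P ν)

instance instGCommRing (ν : AddValuation R (WithTop Γ)) : DirectSum.GCommRing (Component ν) where
  mul_zero {γ δ} x := by
    obtain ⟨a, ha, rfl⟩ := cls_surj ν γ x
    change componentMul ν (cls ν γ a ha) (cls ν δ 0 (zero_mem _)) = cls ν _ 0 (zero_mem _)
    rw [componentMul_cls]
    congr 1
    exact mul_zero a
  zero_mul {γ δ} y := by
    obtain ⟨b, hb, rfl⟩ := cls_surj ν δ y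
    change componentMul ν (cls ν γ 0 (zero_mem _)) (cls ν δ b hb) = cls ν _ 0 (zero_mem _)
    rw [componentMul_cls]
    congr 1
    exact zero_mul b
  mul_add {γ δ} x y z := by
    obtain ⟨a, ha, rfl⟩ := cls_surj ν γ x
    obtain ⟨b, hb, rfl⟩ := cls_surj ν δ y
    obtain ⟨c, hc, rfl⟩ := cls_surj ν δ z
    change componentMul ν (cls ν γ a ha) (cls ν δ (b + c) (add_mem hb hc)) =
      cls ν (γ + δ) (a * b + a * c) (add_mem (mul_mem_P ν ha hb) (mul_mem_P ν ha hc))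
    rw [componentMul_cls]
    congr 1
    exact mul_add a b c
  add_mul {γ δ} x y z := by
    obtain ⟨a, ha, rfl⟩ := cls_surj ν γ x
    obtain ⟨b, hb, rfl⟩ := cls_surj ν γ y
    obtain ⟨c, hc, rfl⟩ := cls_surj ν δ z
    change componentMul ν (cls ν γ (a + b) (add_mem ha hb)) (cls ν δ c hc) =
      cls ν (γ + δ) (a * c + b * c) (add_mem (mul_mem_P ν ha hc) (mul_mem_P ν hb hc))
    rw [componentMul_cls]
    congr 1
    exact add_mul a b c
  one_mul := by
    rintro ⟨γ, x⟩
    obtain ⟨a, ha, rfl⟩ := cls_surj ν γ x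
    exact cls_congr ν (zero_add γ) (one_mul a) _ _
  mul_one := by
    rintro ⟨γ, x⟩
    obtain ⟨a, ha, rfl⟩ := cls_surj ν γ x
    exact cls_congr ν (add_zero γ) (mul_one a) _ _
  mul_assoc := by
    rintro ⟨γ, x⟩ ⟨δ, y⟩ ⟨ε, z⟩
    obtain ⟨a, ha, rfl⟩ := cls_surj ν γ x
    obtain ⟨b, hb, rfl⟩ := cls_surj ν δ y
    obtain ⟨c, hc, rfl⟩ := cls_surj ν ε z
    exact cls_congr ν (add_assoc γ δ ε) (mul_assoc a b c) _ _
  mul_comm := by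
    rintro ⟨γ, x⟩ ⟨δ, y⟩
    obtain ⟨a, ha, rfl⟩ := cls_surj ν γ x
    obtain ⟨b, hb, rfl⟩ := cls_surj ν δ y
    exact cls_congr ν (add_comm γ δ) (mul_comm a b) _ _
  natCast n := n • cls ν 0 1 (one_mem_P ν)
  natCast_zero := zero_nsmul _
  natCast_succ n := succ_nsmul _ n
  intCast n := n • cls ν 0 1 (one_mem_P ν)
  intCast_ofNat n := natCast_zsmul _ n
  intCast_negSucc_ofNat n := negSucc_zsmul _ n

/-- The graded ring `gr_ν(R) = ⨁_γ P_γ / P_γ⁺`, where `γ` runs over the finite values of `ν`. -/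
abbrev Gr (ν : AddValuation R (WithTop Γ)) : Type _ :=
  DirectSum (valueMonoid ν) (Component ν)

theorem untop_mem (ν : AddValuation R (WithTop Γ)) (a : R) (h : ν a ≠ ⊤) :
    (ν a).untop h ∈ valueMonoid ν :=
  ⟨a, (WithTop.coe_untop _ h).symm⟩

theorem mem_P_untop (ν : AddValuation R (WithTop Γ)) (a : R) (h : ν a ≠ ⊤) :
    a ∈ P ν ((⟨(ν a).untop h, untop_mem ν a h⟩ : valueMonoid ν) : Γ) :=
  le_of_eq (WithTop.coe_untop _ h)

/-- The initial form `in_ν(a)`: the image of `a` in `P_{ν a} / P_{ν a}⁺ ⊆ gr_ν(R)` if `ν a` is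
finite, and `0` if `a` lies in the support of `ν`. -/
noncomputable def initialForm (ν : AddValuation R (WithTop Γ)) (a : R) : Gr ν :=
  if h : ν a = ⊤ then 0
  else
    DirectSum.of (Component ν) ⟨(ν a).untop h, untop_mem ν a h⟩
      (cls ν ⟨(ν a).untop h, untop_mem ν a h⟩ a (mem_P_untop ν a h))

end GradedVal

/-!
Write `in(f)` for the initial form of `f` in `gr_ν`, and view `μ` as a valuation on `K[X]`.

Two polynomials with `ν a < ν (a - b)` have the same initial form, and a product is homogeneous only
if both factors are (`GradedVal.exists_initialForm_of_mul_eq`), so that divisibility and units in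
`gr_ν` can be studied on representatives in `K[X]`. The support of `ν` is zero, for otherwise `ν`
would descend to an extension of `ν₀` to `AdjoinRoot F`, which can only be `μ`
(`map_ne_top_of_lt_unique_extension`).

Let `φ` have minimal degree among the polynomials with `ν φ < μ φ`. Division by `φ` shows that
`in(φ)` generates the kernel of `gr_ν → gr_μ`, a prime ideal (`lt_map_sub_div_mul`). Hence `in(φ)` is
irreducible (`irreducible_initialForm`), and `in(F) = in(φ) ^ r * in(h)` with `ν h = μ h`
(`exists_initialForm_eq_pow_mul`), where `r ≥ 1` because `μ F = ∞`.

It remains to see that `in(h)` is a unit (`isUnit_initialForm_of_unique_extension`). Since `in(h)`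
divides `in(F)`, if it is not a unit, there is an extension of `ν₀` to `AdjoinRoot F` that is positive
on all `f` with `ν f = 0` and `in(h) ∣ in(f)`. By uniqueness this extension is `μ`. But `μ h` is
torsion over the values of `ν₀`, as `AdjoinRoot F` is algebraic over `K`, so some `f = c⁻¹ * h ^ e`
has `ν f = μ f = 0`, a contradiction.
-/

/-! ### Initial forms in the graded ring of a valuation -/

namespace GradedVal

variable {R : Type*} [CommRing R]
  {Γ : Type*} [AddCommGroup Γ] [LinearOrder Γ] [IsOrderedAddMonoid Γ]
  (ν : AddValuation R (WithTop Γ))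

variable {ν} in
theorem mem_P_of_eq {a : R} {γ : valueMonoid ν} (h : ν a = ((γ : Γ) : WithTop Γ)) :
    a ∈ P ν (γ : Γ) :=
  h.ge

theorem initialForm_eq_of {a : R} (γ : valueMonoid ν) (h : ν a = ((γ : Γ) : WithTop Γ)) :
    initialForm ν a = DirectSum.of (Component ν) γ (cls ν γ a (mem_P_of_eq h)) := by
  have ht : ν a ≠ ⊤ := by rw [h]; exact WithTop.coe_ne_top
  have e : (⟨(ν a).untop ht, untop_mem ν a ht⟩ : valueMonoid ν) = γ :=
    Subtype.ext (by simp [h])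
  rw [initialForm, dif_neg ht]
  exact DirectSum.of_eq_of_gradedMonoid_eq (cls_congr ν e rfl _ _)

theorem exists_valueMonoid {a : R} (h : ν a ≠ ⊤) :
    ∃ γ : valueMonoid ν, ν a = ((γ : Γ) : WithTop Γ) :=
  ⟨⟨(ν a).untop h, untop_mem ν a h⟩, (WithTop.coe_untop _ h).symm⟩

theorem initialForm_one : initialForm ν 1 = 1 :=
  initialForm_eq_of ν 0 (by simp)

theorem initialForm_mul (a b : R) :
    initialForm ν (a * b) = initialForm ν a * initialForm ν b := by
  by_cases ha : ν a = ⊤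
  · have h : ν (a * b) = ⊤ := by simp [ha]
    rw [initialForm, dif_pos h, initialForm, dif_pos ha, zero_mul]
  by_cases hb : ν b = ⊤
  · have h : ν (a * b) = ⊤ := by simp [hb]
    rw [initialForm, dif_pos h, initialForm, initialForm, dif_pos hb, mul_zero]
  obtain ⟨γ, hγ⟩ := exists_valueMonoid ν ha
  obtain ⟨δ, hδ⟩ := exists_valueMonoid ν hb
  rw [initialForm_eq_of ν γ hγ, initialForm_eq_of ν δ hδ,
    initialForm_eq_of ν (γ + δ) (by rw [ν.map_mul, hγ, hδ]; rfl), DirectSum.of_mul_of]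
  rfl

theorem initialForm_pow (a : R) (n : ℕ) : initialForm ν (a ^ n) = initialForm ν a ^ n := by
  induction n with
  | zero => simp [initialForm_one]
  | succ n ih => rw [pow_succ, initialForm_mul, ih, pow_succ]

theorem cls_eq_zero_iff (γ : valueMonoid ν) {a : R} (ha : a ∈ P ν (γ : Γ)) :
    cls ν γ a ha = 0 ↔ ((γ : Γ) : WithTop Γ) < ν a := by
  rw [← cls_zero, cls_eq_iff]
  change _ < ν (-a + 0) ↔ _
  rw [add_zero, ν.map_neg]

theorem initialForm_eq_of_lt {a b : R} (h : ν a < ν (a - b)) :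
    initialForm ν a = initialForm ν b := by
  obtain ⟨γ, hγ⟩ := exists_valueMonoid ν h.ne_top
  have hb : ν b = ν a := ν.map_eq_of_lt_sub (by rwa [ν.map_sub_swap])
  rw [initialForm_eq_of ν γ hγ, initialForm_eq_of ν γ (hb.trans hγ)]
  congr 1
  rw [cls_eq_iff]
  change _ < ν (-a + b)
  rwa [← hγ, neg_add_eq_sub, ν.map_sub_swap]

theorem initialForm_ne_zero {a : R} (h : ν a ≠ ⊤) : initialForm ν a ≠ 0 := by
  obtain ⟨γ, hγ⟩ := exists_valueMonoid ν h
  rw [initialForm_eq_of ν γ hγ]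
  intro h0
  have := (cls_eq_zero_iff ν γ (mem_P_of_eq hγ)).1
    (DirectSum.of_injective (β := Component ν) γ (h0.trans (map_zero _).symm))
  exact this.ne hγ.symm

theorem lt_of_initialForm_eq {a b : R} (ha : ν a ≠ ⊤)
    (h : initialForm ν a = initialForm ν b) : ν a < ν (a - b) := by
  have hb : ν b ≠ ⊤ := by
    intro hb
    refine initialForm_ne_zero ν ha (h.trans ?_)
    rw [initialForm, dif_pos hb]
  obtain ⟨γ, hγ⟩ := exists_valueMonoid ν ha
  obtain ⟨δ, hδ⟩ := exists_valueMonoid ν hb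
  have h0 := initialForm_ne_zero ν ha
  rw [initialForm_eq_of ν γ hγ] at h h0
  rw [initialForm_eq_of ν δ hδ] at h
  have e : γ = δ := by
    by_contra hne
    have := congrArg (fun z => z γ) h
    simp only [DirectSum.of_eq_same] at this
    rw [DirectSum.of_eq_of_ne _ _ _ hne] at this
    exact h0 (by rw [this, map_zero])
  subst e
  have := (cls_eq_iff ν _ _ _).1 (DirectSum.of_injective (β := Component ν) _ h)
  rw [hγ, ν.map_sub_swap, ← neg_add_eq_sub]
  exact this

theorem exists_initialForm_eq_of {γ : valueMonoid ν} {x : Component ν γ} (hx : x ≠ 0) :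
    ∃ a, ν a = ((γ : Γ) : WithTop Γ) ∧ DirectSum.of (Component ν) γ x = initialForm ν a := by
  obtain ⟨a, ha, rfl⟩ := cls_surj ν γ x
  rw [Ne, cls_eq_zero_iff] at hx
  have h : ν a = ((γ : Γ) : WithTop Γ) := le_antisymm (not_lt.1 hx) ha
  exact ⟨a, h, (initialForm_eq_of ν γ h).symm⟩

theorem componentMul_ne_zero {γ δ : valueMonoid ν} {x : Component ν γ} {y : Component ν δ}
    (hx : x ≠ 0) (hy : y ≠ 0) : componentMul ν x y ≠ 0 := by
  obtain ⟨a, ha, rfl⟩ := cls_surj ν γ x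
  obtain ⟨b, hb, rfl⟩ := cls_surj ν δ y
  rw [Ne, cls_eq_zero_iff] at hx hy
  have ha' : ν a = ((γ : Γ) : WithTop Γ) := le_antisymm (not_lt.1 hx) ha
  have hb' : ν b = ((δ : Γ) : WithTop Γ) := le_antisymm (not_lt.1 hy) hb
  rw [componentMul_cls, Ne, cls_eq_zero_iff, ν.map_mul, ha', hb']
  exact lt_irrefl _

/-- If `(i, j)` is the only pair of degrees of components of `x` and `y` with sum `i + j`, then the
component of `x * y` of degree `i + j` is a single product. -/
theorem mul_apply_of_unique {x y : Gr ν} {i j : valueMonoid ν}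
    (h : ∀ k l, x k ≠ 0 → y l ≠ 0 → k + l = i + j → k = i ∧ l = j) :
    (x * y) (i + j) = componentMul ν (x i) (y j) := by
  classical
  rw [DirectSum.mul_eq_sum_support_ghas_mul, DFinsupp.finsetSum_apply]
  have key : ∀ p : valueMonoid ν × valueMonoid ν, p ≠ (i, j) → x p.1 ≠ 0 → y p.2 ≠ 0 →
      DirectSum.of (Component ν) _ (GradedMonoid.GMul.mul (x p.1) (y p.2)) (i + j) = 0 := by
    rintro ⟨k, l⟩ hne hk hl
    refine DirectSum.of_eq_of_ne _ _ _ fun e => hne ?_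
    obtain ⟨rfl, rfl⟩ := h k l hk hl e.symm
    rfl
  rw [Finset.sum_eq_single (i, j)]
  · exact DirectSum.of_eq_same _ _
  · intro p hp hne
    rw [Finset.mem_product, DFinsupp.mem_support_toFun, DFinsupp.mem_support_toFun] at hp
    exact key p hne hp.1 hp.2
  · intro hp
    rw [Finset.mem_product, DFinsupp.mem_support_toFun, DFinsupp.mem_support_toFun,
      not_and_or, not_not, not_not] at hp
    rw [DirectSum.of_eq_same]
    rcases hp with hp | hp
    · dsimp only
      rw [hp]; exact DirectSum.GCommRing.toGRing.zero_mul _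
    · dsimp only
      rw [hp]; exact DirectSum.GCommRing.toGRing.mul_zero _

/-- In `gr_ν(R)`, the factors of a nonzero homogeneous element are homogeneous: the products of
the lowest components and of the highest components of the factors do not vanish, and they have the
same degree only if each factor has a single component. -/
theorem exists_initialForm_of_mul_eq {x y : Gr ν} {a : R} (ha : ν a ≠ ⊤)
    (h : x * y = initialForm ν a) :
    ∃ b c, x = initialForm ν b ∧ y = initialForm ν c := by
  classical
  have h0 := initialForm_ne_zero ν ha
  have hne : ∀ {z : Gr ν}, z ≠ 0 → (DFinsupp.support z).Nonempty := by
    intro z hz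
    rw [Finset.nonempty_iff_ne_empty]
    exact fun e => hz (DFinsupp.support_eq_empty.1 e)
  have hx : (DFinsupp.support x).Nonempty := hne (by rintro rfl; exact h0 (by rw [← h, zero_mul]))
  have hy : (DFinsupp.support y).Nonempty := hne (by rintro rfl; exact h0 (by rw [← h, mul_zero]))
  obtain ⟨γ, hγ⟩ := exists_valueMonoid ν ha
  rw [initialForm_eq_of ν γ hγ] at h
  have hdeg : ∀ k, (x * y) k ≠ 0 → k = γ := by
    intro k hk
    by_contra hne
    rw [h, DirectSum.of_eq_of_ne _ _ _ hne] at hk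
    exact hk rfl
  have mem : ∀ {z : Gr ν} {k}, k ∈ DFinsupp.support z ↔ z k ≠ 0 := DFinsupp.mem_support_toFun _ _
  have hmax := hdeg _ (by
    rw [mul_apply_of_unique ν (i := (DFinsupp.support x).max' hx)
      (j := (DFinsupp.support y).max' hy)]
    · exact componentMul_ne_zero ν (mem.1 (Finset.max'_mem _ _)) (mem.1 (Finset.max'_mem _ _))
    · intro k l hk hl e
      exact (add_eq_add_iff_eq_and_eq (Finset.le_max' _ _ (mem.2 hk))
        (Finset.le_max' _ _ (mem.2 hl))).1 e)
  have hmin := hdeg _ (by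
    rw [mul_apply_of_unique ν (i := (DFinsupp.support x).min' hx)
      (j := (DFinsupp.support y).min' hy)]
    · exact componentMul_ne_zero ν (mem.1 (Finset.min'_mem _ _)) (mem.1 (Finset.min'_mem _ _))
    · intro k l hk hl e
      have := (add_eq_add_iff_eq_and_eq (Finset.min'_le _ _ (mem.2 hk))
        (Finset.min'_le _ _ (mem.2 hl))).1 e.symm
      exact ⟨this.1.symm, this.2.symm⟩)
  have heq := (add_eq_add_iff_eq_and_eq (Finset.min'_le_max' _ hx)
    (Finset.min'_le_max' _ hy)).1 (hmin.trans hmax.symm)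
  have single : ∀ {z : Gr ν} (hz : (DFinsupp.support z).Nonempty),
      (DFinsupp.support z).min' hz = (DFinsupp.support z).max' hz →
        ∃ b, z = initialForm ν b := by
    intro z hz e
    have hz' : z = DirectSum.of (Component ν) _ (z ((DFinsupp.support z).max' hz)) := by
      refine DFinsupp.ext fun k => ?_
      by_cases hk : k = (DFinsupp.support z).max' hz
      · rw [hk]
        exact (DirectSum.of_eq_same _ _).symm
      · refine Eq.trans ?_ (DirectSum.of_eq_of_ne _ _ _ hk).symm
        by_contra hk'
        refine hk (le_antisymm (Finset.le_max' _ _ (mem.2 hk')) ?_)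
        rw [← e]
        exact Finset.min'_le _ _ (mem.2 hk')
    obtain ⟨b, -, hb⟩ := exists_initialForm_eq_of ν (mem.1 (Finset.max'_mem _ hz))
    exact ⟨b, hz'.trans hb⟩
  obtain ⟨b, hb⟩ := single hx heq.1
  obtain ⟨c, hc⟩ := single hy heq.2
  exact ⟨b, c, hb, hc⟩

theorem isUnit_initialForm_iff {a : R} :
    IsUnit (initialForm ν a) ↔ ∃ b, 0 < ν (1 - a * b) := by
  have h1 : ν 1 ≠ ⊤ := by
    rw [ν.map_one]
    exact WithTop.zero_ne_top
  constructor
  · rintro ⟨u, hu⟩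
    have huv : initialForm ν a * ↑u⁻¹ = initialForm ν 1 := by
      rw [← hu, Units.mul_inv, initialForm_one]
    obtain ⟨-, c, -, hc⟩ := exists_initialForm_of_mul_eq ν h1 huv
    refine ⟨c, ?_⟩
    rw [hc, ← initialForm_mul] at huv
    have := lt_of_initialForm_eq ν h1 huv.symm
    rwa [ν.map_one] at this
  · rintro ⟨b, h⟩
    refine IsUnit.of_mul_eq_one (initialForm ν b) ?_
    rw [← initialForm_mul, ← initialForm_one]
    exact (initialForm_eq_of_lt ν (by rwa [ν.map_one])).symm

end GradedVal

/-! ### Extending a valuation along an algebraic extension -/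

/-- The value group of a valuation on an algebraic extension of `K` is torsion over that of `K`:
two of the terms of a polynomial relation for `x` must have the same value. -/
theorem Valuation.exists_pow_eq_algebraMap {K L : Type*} [Field K] [Field L] [Algebra K L]
    [Algebra.IsAlgebraic K L] {Γ₀ : Type*} [LinearOrderedCommGroupWithZero Γ₀]
    (v : Valuation L Γ₀) {x : L} (hx : x ≠ 0) :
    ∃ e : ℕ, ∃ c : K, e ≠ 0 ∧ c ≠ 0 ∧ v (x ^ e) = v (algebraMap K L c) := by
  obtain ⟨p, hp, hpx⟩ := Algebra.IsAlgebraic.isAlgebraic (R := K) x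
  have hx' : v x ≠ 0 := v.ne_zero_iff.2 hx
  let t : ℕ → L := fun i => algebraMap K L (p.coeff i) * x ^ i
  have hsum : ∑ i ∈ p.support, t i = 0 := by
    rw [← hpx, aeval_eq_sum_range, p.support.sum_subset (s₂ := Finset.range (p.natDegree + 1))]
    · simp [t, Algebra.smul_def]
    · intro i hi
      exact Finset.mem_range.2 (Nat.lt_succ_of_le (le_natDegree_of_mem_supp i hi))
    · intro i _ hi
      simp [t, notMem_support_iff.1 hi]
  have key : ∀ i j, i < j → p.coeff i ≠ 0 → p.coeff j ≠ 0 → v (t i) = v (t j) →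
      ∃ e : ℕ, ∃ c : K, e ≠ 0 ∧ c ≠ 0 ∧ v (x ^ e) = v (algebraMap K L c) := by
    intro i j hij hi hj h
    refine ⟨j - i, p.coeff i / p.coeff j, by omega, div_ne_zero hi hj, ?_⟩
    have hj' : v (algebraMap K L (p.coeff j)) ≠ 0 := v.ne_zero_iff.2 (by simpa using hj)
    rw [map_div₀, map_div₀, eq_div_iff hj']
    refine mul_right_cancel₀ (pow_ne_zero i hx') ?_
    rw [← map_pow v x i, ← map_mul, ← map_mul, ← map_mul]
    refine Eq.trans ?_ h.symm
    congr 1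
    rw [mul_right_comm, ← pow_add, Nat.sub_add_cancel hij.le, mul_comm]
  obtain ⟨i, hi, hmax⟩ := p.support.exists_max_image (fun i => v (t i))
    (support_nonempty.2 hp)
  by_cases hd : ∃ j ∈ p.support, j ≠ i ∧ v (t i) = v (t j)
  · obtain ⟨j, hj, hne, h⟩ := hd
    rcases lt_or_gt_of_ne hne with hlt | hlt
    · exact key j i hlt (mem_support_iff.1 hj) (mem_support_iff.1 hi) h.symm
    · exact key i j hlt (mem_support_iff.1 hi) (mem_support_iff.1 hj) h
  · push Not at hd
    have hti : v (t i) ≠ 0 := by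
      rw [v.ne_zero_iff]
      exact mul_ne_zero (by simpa using mem_support_iff.1 hi) (pow_ne_zero _ hx)
    have hlt : v (∑ j ∈ p.support.erase i, t j) < v (t i) := by
      refine v.map_sum_lt hti fun j hj => ?_
      obtain ⟨hne, hj⟩ := Finset.mem_erase.1 hj
      exact lt_of_le_of_ne (hmax j hj) (hd j hj hne).symm
    rw [← Finset.add_sum_erase _ _ hi] at hsum
    rw [eq_neg_of_add_eq_zero_left hsum, v.map_neg] at hlt
    exact absurd hlt (lt_irrefl _)

/-- A valuation `v` on an algebraic extension `L` of `K` that dominates an additive valuation `ν₀`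
of `K` with values in a divisible group `Γ` is equivalent to an extension of `ν₀` with values in
`Γ`; of the equivalence only the statement about units is recorded. The value of `x` is the `e`-th
part of `ν₀ c`, where `c` in `K` has the same `v`-value as `x ^ e`. -/
theorem exists_addValuation_extending {K L : Type*} [Field K] [Field L] [Algebra K L]
    [Algebra.IsAlgebraic K L] {Γ₀ : Type*} [LinearOrderedCommGroupWithZero Γ₀]
    {Γ : Type*} [AddCommGroup Γ] [LinearOrder Γ] [IsOrderedAddMonoid Γ]
    (hΓ : ∀ n : ℕ, n ≠ 0 → ∀ γ : Γ, ∃ δ : Γ, n • δ = γ)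
    (ν₀ : AddValuation K (WithTop Γ)) (v : Valuation L Γ₀)
    (hle : ∀ c : K, 0 ≤ ν₀ c → v (algebraMap K L c) ≤ 1)
    (hlt : ∀ c : K, 0 < ν₀ c → v (algebraMap K L c) < 1) :
    ∃ μ : AddValuation L (WithTop Γ), μ.comap (algebraMap K L) = ν₀ ∧
      ∀ x, μ x = 0 → v x = 1 := by
  classical
  -- On `K` the two valuations are equivalent.
  have hmono : ∀ c d : K, c ≠ 0 → d ≠ 0 →
      v (algebraMap K L c) ≤ v (algebraMap K L d) → ν₀ d ≤ ν₀ c := by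
    intro c d hc hd h
    by_contra! hcd
    have hv : v (algebraMap K L c) ≠ 0 := v.ne_zero_iff.2 (by simpa using hc)
    refine (hlt (d / c) ?_).not_ge ?_
    · obtain ⟨γ, hγ⟩ := WithTop.ne_top_iff_exists.1 (ν₀.ne_top_iff.2 hc)
      obtain ⟨δ, hδ⟩ := WithTop.ne_top_iff_exists.1 (ν₀.ne_top_iff.2 hd)
      have : ν₀ (d / c) + ν₀ c = ν₀ d := by rw [← ν₀.map_mul, div_mul_cancel₀ _ hc]
      by_contra! h0
      have := add_le_add_left h0 (ν₀ c)
      rw [zero_add] at this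
      exact absurd hcd (not_lt.2 (by simp_all))
    · rw [map_div₀, map_div₀, le_div_iff₀ (zero_lt_iff.2 hv), one_mul]
      exact h
  -- `Q x δ` says that `δ` has to be the value of `x`.
  let Q : L → Γ → Prop := fun x δ => ∃ e : ℕ, ∃ c : K, e ≠ 0 ∧ c ≠ 0 ∧
    v (x ^ e) = v (algebraMap K L c) ∧ ν₀ c = ((e • δ : Γ) : WithTop Γ)
  have hex : ∀ x : L, x ≠ 0 → ∃ δ, Q x δ := by
    intro x hx
    obtain ⟨e, c, he, hc, h⟩ := v.exists_pow_eq_algebraMap (K := K) hx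
    obtain ⟨γ, hγ⟩ := WithTop.ne_top_iff_exists.1 (ν₀.ne_top_iff.2 hc)
    obtain ⟨δ, hδ⟩ := hΓ e he γ
    exact ⟨δ, e, c, he, hc, h, by rw [hδ, hγ]⟩
  have hanti : ∀ x y δ ε, Q x δ → Q y ε → v x ≤ v y → ε ≤ δ := by
    rintro x y δ ε ⟨m, c, hm, hc, hxc, hδ⟩ ⟨n, d, hn, hd, hyd, hε⟩ hxy
    have h : v (algebraMap K L (c ^ n)) ≤ v (algebraMap K L (d ^ m)) := by
      rw [map_pow, map_pow, map_pow, map_pow, ← hxc, ← hyd, map_pow, map_pow, ← pow_mul,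
        ← pow_mul, mul_comm n m]
      exact pow_le_pow_left₀ zero_le hxy _
    have h' := hmono _ _ (pow_ne_zero _ hc) (pow_ne_zero _ hd) h
    rw [ν₀.map_pow, ν₀.map_pow, hδ, hε, ← WithTop.coe_nsmul, ← WithTop.coe_nsmul,
      WithTop.coe_le_coe, ← mul_nsmul, ← mul_nsmul, mul_comm] at h'
    exact (nsmul_le_nsmul_iff_right (mul_ne_zero hm hn)).1 h'
  have huniq : ∀ x δ ε, Q x δ → Q x ε → δ = ε := fun x δ ε h h' =>
    le_antisymm (hanti _ _ _ _ h' h le_rfl) (hanti _ _ _ _ h h' le_rfl)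
  choose! w hw using hex
  have hK : ∀ c : K, c ≠ 0 → ∀ γ : Γ, ν₀ c = γ → Q (algebraMap K L c) γ := fun c hc γ h =>
    ⟨1, c, one_ne_zero, hc, by rw [pow_one], by rw [one_nsmul, h]⟩
  have hmul : ∀ x y δ ε, Q x δ → Q y ε → Q (x * y) (δ + ε) := by
    rintro x y δ ε ⟨m, c, hm, hc, hxc, hδ⟩ ⟨n, d, hn, hd, hyd, hε⟩
    refine ⟨m * n, c ^ n * d ^ m, mul_ne_zero hm hn,
      mul_ne_zero (pow_ne_zero _ hc) (pow_ne_zero _ hd), ?_, ?_⟩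
    · simp only [map_mul, map_pow] at hxc hyd ⊢
      rw [← hxc, ← hyd, mul_pow, ← pow_mul, ← pow_mul, mul_comm n m]
    · rw [ν₀.map_mul, ν₀.map_pow, ν₀.map_pow, hδ, hε, ← WithTop.coe_nsmul, ← WithTop.coe_nsmul,
        ← WithTop.coe_add, ← mul_nsmul, ← mul_nsmul, mul_comm n m, nsmul_add]
  let f : L → WithTop Γ := fun x => if x = 0 then ⊤ else (w x : WithTop Γ)
  have f0 : f 0 = ⊤ := if_pos rfl
  have fne : ∀ {x}, x ≠ 0 → f x = w x := fun h => if_neg h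
  have fK : ∀ c : K, f (algebraMap K L c) = ν₀ c := by
    intro c
    by_cases hc : c = 0
    · rw [hc, map_zero, f0, ν₀.map_zero]
    · obtain ⟨γ, hγ⟩ := WithTop.ne_top_iff_exists.1 (ν₀.ne_top_iff.2 hc)
      have hc' : algebraMap K L c ≠ 0 := by simpa using hc
      rw [fne hc', ← hγ, huniq _ _ _ (hw _ hc') (hK c hc γ hγ.symm)]
  have f1 : f 1 = 0 := by rw [← map_one (algebraMap K L), fK, ν₀.map_one]
  have fmul : ∀ x y, f (x * y) = f x + f y := by
    intro x y
    by_cases hx : x = 0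
    · rw [hx, zero_mul, f0, top_add]
    by_cases hy : y = 0
    · rw [hy, mul_zero, f0, add_top]
    rw [fne hx, fne hy, fne (mul_ne_zero hx hy),
      huniq _ _ _ (hw _ (mul_ne_zero hx hy)) (hmul _ _ _ _ (hw x hx) (hw y hy)), WithTop.coe_add]
  have fanti : ∀ x y, v x ≤ v y → f y ≤ f x := by
    intro x y h
    by_cases hx : x = 0
    · rw [hx, f0]; exact le_top
    by_cases hy : y = 0
    · rw [hy, map_zero, le_zero_iff, v.zero_iff] at h
      exact absurd h hx
    rw [fne hx, fne hy]
    exact WithTop.coe_le_coe.2 (hanti _ _ _ _ (hw x hx) (hw y hy) h)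
  have fadd : ∀ x y, min (f x) (f y) ≤ f (x + y) := by
    intro x y
    rcases le_max_iff.1 (v.map_add x y) with h | h
    · exact min_le_of_left_le (fanti _ _ h)
    · exact min_le_of_right_le (fanti _ _ h)
  refine ⟨AddValuation.of f f0 f1 fadd fmul, AddValuation.ext fK, fun x hx => ?_⟩
  change f x = 0 at hx
  have hx0 : x ≠ 0 := by
    rintro rfl
    rw [f0] at hx
    exact WithTop.top_ne_zero hx
  obtain ⟨e, c, he, hc, hxc, h⟩ := hw x hx0
  rw [fne hx0, WithTop.coe_eq_zero] at hx
  rw [hx, nsmul_zero, WithTop.coe_zero] at h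
  have hc1 : v (algebraMap K L c) = 1 := by
    refine le_antisymm (hle c h.ge) ?_
    have := hle c⁻¹ (by rw [ν₀.map_inv, h, neg_zero])
    rw [map_inv₀, map_inv₀] at this
    exact (inv_le_one₀ (zero_lt_iff.2 (v.ne_zero_iff.2 (by simpa using hc)))).1 this
  rw [hc1, map_pow] at hxc
  exact (pow_eq_one_iff_of_nonneg zero_le he).1 hxc

/-! ### Polynomials on which a larger valuation is strictly larger -/

theorem AddValuation.lt_of_le_of_lt_sub {R : Type*} [CommRing R]
    {Γ₀ : Type*} [LinearOrderedAddCommMonoidWithTop Γ₀] {ν μ : AddValuation R Γ₀}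
    (hle : ∀ f, ν f ≤ μ f) {a b : R} (h : ν a < ν (a - b)) (hb : ν b < μ b) : ν a < μ a := by
  have hab : ν b = ν a := ν.map_eq_of_lt_sub (by rwa [ν.map_sub_swap])
  have := μ.map_lt_add (h.trans_le (hle _)) (hab ▸ hb)
  rwa [sub_add_cancel] at this

section Augmentation

variable {K : Type*} [Field K] {Γ : Type*} [AddCommGroup Γ] [LinearOrder Γ] [IsOrderedAddMonoid Γ]
  {ν μ : AddValuation K[X] (WithTop Γ)}

theorem lt_map_mul (htriv : ∀ f, f ≠ 0 → ν f ≠ ⊤) (hle : ∀ f, ν f ≤ μ f) {a b : K[X]} (ha : a ≠ 0)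
    (hb : ν b < μ b) : ν (a * b) < μ (a * b) := by
  rw [ν.map_mul, μ.map_mul]
  exact (WithTop.add_lt_add_left (htriv a ha) hb).trans_le (by gcongr; exact hle a)

theorem lt_or_lt_of_lt_map_mul {a b : K[X]} (h : ν (a * b) < μ (a * b)) :
    ν a < μ a ∨ ν b < μ b := by
  by_contra! h'
  rw [ν.map_mul, μ.map_mul] at h
  exact h.not_ge (add_le_add h'.1 h'.2)

/-- If `φ` has minimal degree among the polynomials with `ν φ < μ φ`, then its initial form divides
that of every `f` with `ν f < μ f`. The remainder of `f` modulo `φ` has the same value under `ν` and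
`μ`; if that value did not exceed `ν f`, it would be the `μ`-value of a multiple of `φ`. -/
theorem lt_map_sub_div_mul (htriv : ∀ f, f ≠ 0 → ν f ≠ ⊤) (hle : ∀ f, ν f ≤ μ f) {φ : K[X]}
    (hφ : φ ≠ 0) (hmin : ∀ g : K[X], g.degree < φ.degree → ν g = μ g)
    (hφlt : ν φ < μ φ) {f : K[X]} (hf : ν f < μ f) : ν f < ν (f - f / φ * φ) := by
  have hr : f % φ = f - f / φ * φ := by
    rw [eq_sub_iff_add_eq, mul_comm, add_comm, EuclideanDomain.div_add_mod]
  have hrμ : ν (f % φ) = μ (f % φ) := hmin _ (EuclideanDomain.mod_lt f hφ)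
  rw [← hr]
  by_contra! h
  have hrf : μ (f % φ) < μ f := by rw [← hrμ]; exact h.trans_lt hf
  have hq : f / φ * φ = f - f % φ := by rw [hr, sub_sub_cancel]
  have hμq : μ (f / φ * φ) = μ (f % φ) := by rw [hq, μ.map_sub_eq_of_lt_right hrf]
  have hνq : ν (f % φ) ≤ ν (f / φ * φ) := by
    rw [hq]
    exact ν.map_le_sub h le_rfl
  have hq0 : f / φ ≠ 0 := by
    intro h0
    rw [h0, zero_mul, eq_comm, sub_eq_zero] at hq
    exact hrf.ne (by rw [← hq])
  have := lt_map_mul htriv hle hq0 hφlt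
  rw [hμq, ← hrμ] at this
  exact this.not_ge hνq

/-- Dividing repeatedly by `φ` writes every initial form as a power of that of `φ` times the
initial form of some `h` with `ν h = μ h`. -/
theorem exists_initialForm_eq_pow_mul (htriv : ∀ f, f ≠ 0 → ν f ≠ ⊤) (hle : ∀ f, ν f ≤ μ f)
    {φ : K[X]} (hφ : 0 < φ.degree) (hmin : ∀ g : K[X], g.degree < φ.degree → ν g = μ g)
    (hφlt : ν φ < μ φ) (f : K[X]) (hf : f ≠ 0) :
    ∃ (r : ℕ) (h : K[X]), h ≠ 0 ∧ ν h = μ h ∧ (ν f < μ f → 1 ≤ r) ∧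
      GradedVal.initialForm ν f = GradedVal.initialForm ν (φ ^ r * h) := by
  induction hd : f.natDegree using Nat.strong_induction_on generalizing f with
  | _ d ih =>
    by_cases hlt : ν f < μ f
    · have hφ0 : φ ≠ 0 := ne_zero_of_degree_gt hφ
      have hdiv := lt_map_sub_div_mul htriv hle hφ0 hmin hφlt hlt
      have hq0 : f / φ ≠ 0 := by
        intro h0
        rw [h0, zero_mul, sub_zero] at hdiv
        exact hdiv.false
      obtain ⟨r, h, h0, heq, -, hin⟩ := ih _
        (by rw [← hd]; exact natDegree_lt_natDegree hq0 (degree_div_lt hf hφ)) (f / φ) hq0 rfl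
      refine ⟨r + 1, h, h0, heq, fun _ => by omega, ?_⟩
      rw [GradedVal.initialForm_eq_of_lt ν hdiv, GradedVal.initialForm_mul, hin,
        ← GradedVal.initialForm_mul]
      congr 1
      ring
    · exact ⟨0, f, hf, le_antisymm (hle f) (not_lt.1 hlt), fun h => absurd h hlt, by simp⟩

theorem irreducible_initialForm (htriv : ∀ f, f ≠ 0 → ν f ≠ ⊤) (hle : ∀ f, ν f ≤ μ f)
    {φ : K[X]} (hφ : φ ≠ 0) (hmin : ∀ g : K[X], g.degree < φ.degree → ν g = μ g)
    (hφlt : ν φ < μ φ) : Irreducible (GradedVal.initialForm ν φ) := by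
  -- A factor of `in(φ)` in the kernel of `gr_ν → gr_μ` is a multiple of `in(φ)`.
  have key : ∀ b c : K[X],
      GradedVal.initialForm ν φ = GradedVal.initialForm ν b * GradedVal.initialForm ν c →
      ν b < μ b → IsUnit (GradedVal.initialForm ν c) := by
    intro b c h hb
    rw [GradedVal.initialForm_eq_of_lt ν (lt_map_sub_div_mul htriv hle hφ hmin hφlt hb),
      ← GradedVal.initialForm_mul] at h
    have h1 := GradedVal.lt_of_initialForm_eq ν hφlt.ne_top h
    rw [show φ - b / φ * φ * c = φ * (1 - c * (b / φ)) by ring, ν.map_mul] at h1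
    refine (GradedVal.isUnit_initialForm_iff ν).2 ⟨b / φ, ?_⟩
    by_contra! h0
    exact h1.not_ge (by simpa using add_le_add_right h0 (ν φ))
  constructor
  · intro hu
    obtain ⟨c, hlt⟩ := (GradedVal.isUnit_initialForm_iff ν).1 hu
    rw [← ν.map_one] at hlt
    have hc : c ≠ 0 := by
      rintro rfl
      rw [mul_zero, sub_zero] at hlt
      exact hlt.false
    have := AddValuation.lt_of_le_of_lt_sub hle hlt (by
      rw [mul_comm]
      exact lt_map_mul htriv hle hc hφlt)
    simp at this
  · intro x y hxy
    obtain ⟨b, c, rfl, rfl⟩ := GradedVal.exists_initialForm_of_mul_eq ν hφlt.ne_top hxy.symm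
    have hlt := GradedVal.lt_of_initialForm_eq ν hφlt.ne_top
      (hxy.trans (GradedVal.initialForm_mul ν b c).symm)
    have hbcφ : ν (b * c) = ν φ := ν.map_eq_of_lt_sub (by rwa [ν.map_sub_swap])
    have hbc : ν (b * c) < μ (b * c) := by
      refine AddValuation.lt_of_le_of_lt_sub hle (b := φ) ?_ hφlt
      rwa [ν.map_sub_swap, hbcφ]
    rcases lt_or_lt_of_lt_map_mul hbc with h | h
    · exact Or.inr (key b c hxy h)
    · exact Or.inl (key c b (hxy.trans (mul_comm _ _)) h)

end Augmentation

/-! ### Consequences of the uniqueness of the extension -/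

section Unique

variable {K : Type*} [Field K] {Γ : Type*} [AddCommGroup Γ] [LinearOrder Γ] [IsOrderedAddMonoid Γ]
  {ν₀ : AddValuation K (WithTop Γ)} {F : K[X]} {μ : AddValuation (AdjoinRoot F) (WithTop Γ)}
  {ν : AddValuation K[X] (WithTop Γ)}

/-- If `ν` had a nonzero support, it would contain `F`, so that `ν` would come from an extension of
`ν₀` to `AdjoinRoot F`. -/
theorem map_ne_top_of_lt_unique_extension (hF : Irreducible F)
    (hμ_unique : ∀ μ' : AddValuation (AdjoinRoot F) (WithTop Γ),
      μ'.comap (algebraMap K (AdjoinRoot F)) = ν₀ → μ' = μ)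
    (hν : ν.comap (C : K →+* K[X]) = ν₀)
    (hle : ∀ f, ν f ≤ μ.comap (AdjoinRoot.mk F) f) (hne : ν ≠ μ.comap (AdjoinRoot.mk F))
    (f : K[X]) (hf : f ≠ 0) : ν f ≠ ⊤ := by
  have : Fact (Irreducible F) := ⟨hF⟩
  intro htop
  obtain ⟨k, g, hg, rfl⟩ : ∃ (k : ℕ) (g : K[X]), ¬ F ∣ g ∧ f = F ^ k * g :=
    (FiniteMultiplicity.of_prime_left hF.prime hf).exists_eq_pow_mul_and_not_dvd.imp' _
      fun g h => ⟨g, h.2, h.1⟩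
  have hgt : ν g ≠ ⊤ := by
    refine ((hle g).trans_lt (lt_top_iff_ne_top.2 ?_)).ne
    exact μ.ne_top_iff.2 (by rwa [Ne, AdjoinRoot.mk_eq_zero])
  have hFt : ν F = ⊤ := by
    by_contra h
    obtain ⟨γ, hγ⟩ := WithTop.ne_top_iff_exists.1 h
    obtain ⟨δ, hδ⟩ := WithTop.ne_top_iff_exists.1 hgt
    rw [ν.map_mul, ν.map_pow, ← hγ, ← hδ, ← WithTop.coe_nsmul, ← WithTop.coe_add] at htop
    exact WithTop.coe_ne_top htop
  have hs : Ideal.span {F} ≤ ν.supp := by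
    rw [Ideal.span_singleton_le_iff_mem, ν.mem_supp_iff]
    exact hFt
  have hext : AddValuation.comap (AdjoinRoot.mk F) (ν.onQuot hs) = ν := ν.onQuot_comap_eq hs
  refine hne (hext.symm.trans ?_)
  rw [hμ_unique (ν.onQuot hs)]
  rw [← hν]
  exact congrArg (AddValuation.comap C) hext

/-- If the initial form of `h` is not a unit, the polynomials `f` with `0 ≤ ν f` that are congruent
to a multiple of `h` modulo polynomials of positive value form a proper ideal of `{f ∣ 0 ≤ ν f}`. It
contains the multiples of `F` of value at least `0`, because the initial form of `h` divides that of
`F`. A valuation ring of `AdjoinRoot F` dominating the quotient gives an extension of `ν₀`, hence is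
the ring of `μ`. A suitable `c⁻¹ * h ^ e` then lies in its maximal ideal, although it has value `0`
under `μ`. -/
theorem isUnit_initialForm_of_unique_extension
    (hΓ : ∀ n : ℕ, n ≠ 0 → ∀ γ : Γ, ∃ δ : Γ, n • δ = γ) (hF : Irreducible F)
    (hμ : μ.comap (algebraMap K (AdjoinRoot F)) = ν₀)
    (hμ_unique : ∀ μ' : AddValuation (AdjoinRoot F) (WithTop Γ),
      μ'.comap (algebraMap K (AdjoinRoot F)) = ν₀ → μ' = μ)
    (hν : ν.comap (C : K →+* K[X]) = ν₀) {h : K[X]} (hh : ν h ≠ ⊤)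
    (heq : ν h = μ (AdjoinRoot.mk F h)) {p : K[X]} (hFt : ν F ≠ ⊤)
    (hFh : GradedVal.initialForm ν F = GradedVal.initialForm ν (p * h)) :
    IsUnit (GradedVal.initialForm ν h) := by
  have : Fact (Irreducible F) := ⟨hF⟩
  have : Algebra.IsAlgebraic K (AdjoinRoot F) :=
    have := (AdjoinRoot.powerBasis hF.ne_zero).finite
    inferInstance
  by_contra hunit
  have hno : ∀ g, ¬ 0 < ν (1 - h * g) := fun g hg =>
    hunit ((GradedVal.isUnit_initialForm_iff ν).2 ⟨g, hg⟩)
  have hlt := GradedVal.lt_of_initialForm_eq ν hFt hFh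
  have hC : ∀ c : K, ν (C c) = ν₀ c := fun c => by rw [← hν]; rfl
  let A : Subring K[X] :=
    { carrier := {f | 0 ≤ ν f}
      mul_mem' := fun {a b} ha hb => by
        change 0 ≤ ν (a * b)
        rw [ν.map_mul]
        exact add_nonneg ha hb
      one_mem' := by simp
      add_mem' := fun {a b} ha hb => ν.map_le_add ha hb
      zero_mem' := by simp
      neg_mem' := fun {a} ha => by simpa [ν.map_neg] using ha }
  let J : Set K[X] := {f | 0 ≤ ν f ∧ ∃ g, 0 < ν (f - h * g)}
  have hJF : ∀ b, 0 ≤ ν (F * b) → F * b ∈ J := by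
    intro b hb
    refine ⟨hb, p * b, ?_⟩
    by_cases hbt : ν b = ⊤
    · rw [show F * b - h * (p * b) = (F - p * h) * b by ring, ν.map_mul, hbt, add_top]
      exact WithTop.coe_lt_top 0
    · rw [show F * b - h * (p * b) = (F - p * h) * b by ring, ν.map_mul]
      rw [ν.map_mul] at hb
      exact hb.trans_lt (WithTop.add_lt_add_right hbt hlt)
  let I : Ideal (A.map (AdjoinRoot.mk F)) :=
    { carrier := {x | ∃ f ∈ J, AdjoinRoot.mk F f = x}
      zero_mem' := ⟨0, ⟨by simp, 0, by simp⟩, by simp⟩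
      add_mem' := by
        rintro x y ⟨f, ⟨hf, a, ha⟩, hx⟩ ⟨g, ⟨hg, b, hb⟩, hy⟩
        refine ⟨f + g, ⟨ν.map_le_add hf hg, a + b, ?_⟩, by simp [hx, hy]⟩
        rw [show f + g - h * (a + b) = (f - h * a) + (g - h * b) by ring]
        exact ν.map_lt_add ha hb
      smul_mem' := by
        rintro ⟨x, g, hg, hgx⟩ y ⟨f, ⟨hf, a, ha⟩, hy⟩
        refine ⟨g * f, ⟨A.mul_mem hg hf, g * a, ?_⟩, ?_⟩
        · rw [show g * f - h * (g * a) = g * (f - h * a) by ring, ν.map_mul]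
          exact ha.trans_le (le_add_of_nonneg_left hg)
        · rw [map_mul, hy, smul_eq_mul, Subring.coe_mul]
          exact congrArg (· * (y : AdjoinRoot F)) hgx }
  have hI : I ≠ ⊤ := by
    rw [Ideal.ne_top_iff_one]
    rintro ⟨f, ⟨hf, a, ha⟩, h1⟩
    rw [Subring.coe_one, ← map_one (AdjoinRoot.mk F), eq_comm, AdjoinRoot.mk_eq_mk] at h1
    obtain ⟨b, hb⟩ := h1
    obtain ⟨-, d, hd⟩ := hJF b (by rw [← hb]; exact ν.map_le_sub (by simp) hf)
    refine hno (a + d) ?_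
    rw [show 1 - h * (a + d) = (f - h * a) + (F * b - h * d) by rw [← hb]; ring]
    exact ν.map_lt_add ha hd
  obtain ⟨B, hAB, hIB⟩ := Ideal.image_subset_nonunits_valuationSubring I hI
  have hAB' : ∀ f, 0 ≤ ν f → B.valuation (AdjoinRoot.mk F f) ≤ 1 := fun f hf =>
    (B.valuation_le_one_iff _).2 (hAB ⟨f, hf, rfl⟩)
  have hJB : ∀ f ∈ J, B.valuation (AdjoinRoot.mk F f) < 1 := fun f hf =>
    B.mem_nonunits_iff.1
      (hIB ⟨⟨AdjoinRoot.mk F f, f, hf.1, rfl⟩, ⟨f, hf, rfl⟩, rfl⟩)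
  obtain ⟨μ', hμ', hμ'1⟩ := exists_addValuation_extending hΓ ν₀ B.valuation
    (fun c hc => hAB' (C c) (by rwa [hC]))
    (fun c hc => hJB (C c) ⟨by rw [hC]; exact hc.le, 0, by rwa [mul_zero, sub_zero, hC]⟩)
  obtain rfl := hμ_unique μ' hμ'
  have hx : AdjoinRoot.mk F h ≠ 0 := by
    rw [← μ'.ne_top_iff, ← heq]
    exact hh
  -- As `ν h = μ h`, the value of `h` is torsion over the values of `ν₀`.
  obtain ⟨e, c, he, hc, hec⟩ := μ'.toValuation.exists_pow_eq_algebraMap (K := K) hx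
  have hec' : μ' (AdjoinRoot.mk F h ^ e) = ν₀ c := by
    rw [← hμ]
    exact hec
  rw [μ'.map_pow, ← heq] at hec'
  have hz : ν₀ c⁻¹ + ν₀ c = 0 := by
    rw [← ν₀.map_mul, inv_mul_cancel₀ hc, ν₀.map_one]
  have hν0 : ν (C c⁻¹ * h ^ e) = 0 := by
    rw [ν.map_mul, hC, ν.map_pow, hec', hz]
  have hμ0 : μ' (AdjoinRoot.mk F (C c⁻¹ * h ^ e)) = 0 := by
    rw [map_mul, μ'.map_mul, map_pow, μ'.map_pow, ← heq, hec', ← hz, ← hμ]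
    rfl
  refine (hJB (C c⁻¹ * h ^ e) ⟨hν0.ge, C c⁻¹ * h ^ (e - 1), ?_⟩).ne (hμ'1 _ hμ0)
  rw [mul_left_comm, mul_pow_sub_one he, sub_self, ν.map_zero]
  exact WithTop.coe_lt_top 0

end Unique

theorem corollary1p4 {K : Type*} [Field K]
    {Γ : Type*} [AddCommGroup Γ] [LinearOrder Γ] [IsOrderedAddMonoid Γ]
    (hΓ : ∀ n : ℕ, n ≠ 0 → ∀ γ : Γ, ∃ δ : Γ, n • δ = γ)
    (ν₀ : AddValuation K (WithTop Γ))
    (F : K[X]) (hF_monic : F.Monic) (hF_irr : Irreducible F)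
    (μ : AddValuation (AdjoinRoot F) (WithTop Γ))
    (hμ : μ.comap (algebraMap K (AdjoinRoot F)) = ν₀)
    (hμ_unique : ∀ μ' : AddValuation (AdjoinRoot F) (WithTop Γ),
      μ'.comap (algebraMap K (AdjoinRoot F)) = ν₀ → μ' = μ)
    (ν : AddValuation K[X] (WithTop Γ))
    (hν : ν.comap (C : K →+* K[X]) = ν₀)
    (hνμ_le : ∀ f : K[X], ν f ≤ μ.comap (AdjoinRoot.mk F) f)
    (hνμ_ne : ν ≠ μ.comap (AdjoinRoot.mk F)) :
    ∃ (u : (GradedVal.Gr ν)ˣ) (φ : GradedVal.Gr ν) (r : ℕ),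
      Irreducible φ ∧ 1 ≤ r ∧ GradedVal.initialForm ν F = (u : GradedVal.Gr ν) * φ ^ r := by

  have : Fact (Irreducible F) := ⟨hF_irr⟩
  have htriv := map_ne_top_of_lt_unique_extension hF_irr hμ_unique hν hνμ_le hνμ_ne
  let m := μ.comap (AdjoinRoot.mk F)
  have hex : ∃ f, ν f < m f := by
    by_contra! h
    exact hνμ_ne (AddValuation.ext fun f => le_antisymm (hνμ_le f) (h f))
  obtain ⟨φ, hφlt, hφmin⟩ :=
    WellFounded.has_min (measure (natDegree : K[X] → ℕ)).wf {f | ν f < m f} hex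
  have hconst : ∀ c : K, ν (C c) = m (C c) := fun c =>
    (congrArg (fun w : AddValuation K (WithTop Γ) => w c) (hν.trans hμ.symm) :)
  have hφdeg : 0 < φ.degree := by
    by_contra! h
    rw [eq_C_of_degree_le_zero h] at hφlt
    exact hφlt.ne (hconst _)
  have hmin : ∀ g : K[X], g.degree < φ.degree → ν g = m g := by
    intro g hg
    by_contra hne
    refine hφmin g (lt_of_le_of_ne (hνμ_le g) hne) (natDegree_lt_natDegree ?_ hg)
    rintro rfl
    exact hne (by rw [ν.map_zero, m.map_zero])
  obtain ⟨r, h, h0, heq, hr, hin⟩ :=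
    exists_initialForm_eq_pow_mul htriv hνμ_le hφdeg hmin hφlt F hF_irr.ne_zero
  have hFt := htriv F hF_irr.ne_zero
  obtain ⟨u, hu⟩ := isUnit_initialForm_of_unique_extension hΓ hF_irr hμ hμ_unique hν
    (htriv h h0) heq hFt hin
  refine ⟨u, GradedVal.initialForm ν φ, r,
    irreducible_initialForm htriv hνμ_le (ne_zero_of_degree_gt hφdeg) hmin hφlt, hr ?_, ?_⟩
  · have : m F = ⊤ := by
      change μ (AdjoinRoot.mk F F) = ⊤
      rw [AdjoinRoot.mk_self, μ.map_zero]
    rw [this]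
    exact lt_top_iff_ne_top.2 hFt
  · rw [hin, GradedVal.initialForm_mul, GradedVal.initialForm_pow, hu, mul_comm]
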